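/- For $x>0$ let $\Theta(r,s,t,x)$ be the function given by the absolutely convergent series $$\Theta(r,s,t,x)=\sum_{n=1}^{\infty}\sum_{m=1}^{\infty}\frac{1}{n^{r}m^{s}(n+mx)^{t}}$$ for $(r,s,t)\in\mathbb{C}^3$ with $\operatorname{Re}(r+t)>1$, $\operatorname{Re}(s+t)>1$, $\operatorname{Re}(r+s+t)>2$, and by meromorphic continuation elsewhere; in particular, $s\mapsto\Theta(1,s,1,x)$ is given by the series for $\operatorname{Re}(s)>0$ and is continued meromorphically to a right half-plane containing $s=0$. Let $\gamma$ be Euler's constant, $\gamma_1=\lim_{N\to\infty}\left(\sum_{k=1}^{N}\frac{\log k}{k}-\frac{(\log N)^2}{2}\right)$ the first Stieltjes constant, $\zeta$ the Riemann zeta function and $\psi=\Gamma'/\Gamma$ the digamma function. Then for every fixed $x>0$ the series $\sum_{m\ge 1}\frac{\psi(mx)-\log(mx)}{m}$ converges absolutely and, as $s\to0$ in $\mathbb{C}\setminus\{0\}$, $$\Theta(1,s,1,x)=\frac{1}{xs^2}+\frac{\gamma+\log x}{xs}+\frac{1}{x}\bigl(\gamma(\gamma+\log x)+\gamma_1\bigr)+\frac{\zeta(2)}{x^{2}}+\frac{1}{x}\sum_{m=1}^{\infty}\frac{\psi(mx)-\log(mx)}{m}+O(s),$$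 where the implied constant may depend on $x$. -/

import Mathlib

open Filter Topology Asymptotics

/-- The region `𝓓 ⊆ ℂ³` in which the double series `∑ 1 / (n ^ r * m ^ s * (n + m x) ^ t)`
is taken: `Re (r + t) > 1`, `Re (s + t) > 1`, `Re (r + s + t) > 2`. -/
def thetaRegion : Set (ℂ × ℂ × ℂ) :=
  {p | 1 < (p.1 + p.2.2).re ∧ 1 < (p.2.1 + p.2.2).re ∧ 2 < (p.1 + p.2.1 + p.2.2).re}

/-- The generalized Mordell--Tornheim double series
`∑_{n ≥ 1} ∑_{m ≥ 1} 1 / (n ^ r * m ^ s * (n + m x) ^ t)`. -/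
noncomputable def thetaSeries (r s t : ℂ) (x : ℝ) : ℂ :=
  ∑' n : ℕ+, ∑' m : ℕ+,
    1 / (((n : ℕ) : ℂ) ^ r * ((m : ℕ) : ℂ) ^ s *
      (((((n : ℕ) : ℝ) + ((m : ℕ) : ℝ) * x : ℝ)) : ℂ) ^ t)

/-- `F` is a meromorphic continuation, in the second variable, of `z ↦ Θ(r, z, t, x)` to the right
half-plane `Re z > a`: it is meromorphic there (in normal form, i.e. with removable singularities
removed and the value `0` at poles) and it is given by the double series at every point `z` of the
half-plane with `(r, z, t) ∈ 𝓓`. -/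
structure IsThetaContinuation (r t : ℂ) (x : ℝ) (a : ℝ) (F : ℂ → ℂ) : Prop where
  meromorphic : MeromorphicNFOn F {z : ℂ | a < z.re}
  eq_series : ∀ z : ℂ, a < z.re → (r, z, t) ∈ thetaRegion → F z = thetaSeries r z t x

/-- Uniqueness of the continuation: two continuations, possibly to different right half-planes,
agree wherever both are defined. -/
theorem IsThetaContinuation.eq {r t : ℂ} {x : ℝ} (hrt : 1 < (r + t).re) {a b : ℝ} {F G : ℂ → ℂ}
    (hF : IsThetaContinuation r t x a F) (hG : IsThetaContinuation r t x b G)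
    {s : ℂ} (ha : a < s.re) (hb : b < s.re) : F s = G s := by
  set U : Set ℂ := {z : ℂ | max a b < z.re} with hU
  have hUo : IsOpen U := isOpen_lt continuous_const Complex.continuous_re
  have hUc : IsPreconnected U := (convex_halfSpace_re_gt (max a b)).isPreconnected
  have hFm : MeromorphicOn F U := fun z hz =>
    (hF.meromorphic (show a < z.re from lt_of_le_of_lt (le_max_left _ _) hz)).meromorphicAt
  have hGm : MeromorphicOn G U := fun z hz =>
    (hG.meromorphic (show b < z.re from lt_of_le_of_lt (le_max_right _ _) hz)).meromorphicAt
  obtain ⟨c, hc⟩ : ∃ c : ℝ, c = max (max a b) (max (1 - t.re) (2 - r.re - t.re)) := ⟨_, rfl⟩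
  have h1 : max a b ≤ c := hc ▸ le_max_left _ _
  have h2 : 1 - t.re ≤ c := hc ▸ (le_max_left _ _).trans (le_max_right _ _)
  have h3 : 2 - r.re - t.re ≤ c := hc ▸ (le_max_right _ _).trans (le_max_right _ _)
  have heq : ∀ z : ℂ, c < z.re → F z - G z = 0 := by
    intro z hz
    have hz' : (r, z, t) ∈ thetaRegion := by
      refine ⟨hrt, ?_, ?_⟩ <;> simp only [Complex.add_re] <;> linarith
    rw [hF.eq_series z (by linarith [le_max_left a b]) hz',
      hG.eq_series z (by linarith [le_max_right a b]) hz', sub_self]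
  have hy : ((c + 1 : ℝ) : ℂ) ∈ U := by
    show max a b < ((c + 1 : ℝ) : ℂ).re
    rw [Complex.ofReal_re]; linarith
  have hs : s ∈ U := max_lt ha hb
  have hm : MeromorphicOn (F - G) U := hFm.sub hGm
  have hyord : meromorphicOrderAt (F - G) ((c + 1 : ℝ) : ℂ) = ⊤ := by
    rw [meromorphicOrderAt_eq_top_iff]
    refine Filter.Eventually.filter_mono nhdsWithin_le_nhds ?_
    filter_upwards [(isOpen_lt continuous_const Complex.continuous_re).mem_nhds
      (show ((c + 1 : ℝ) : ℂ) ∈ {z : ℂ | c < z.re} by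
        show c < ((c + 1 : ℝ) : ℂ).re
        rw [Complex.ofReal_re]; linarith)] with z hz
    exact heq z hz
  have hsord : meromorphicOrderAt (F - G) s = ⊤ := by
    by_contra hne
    exact hm.meromorphicOrderAt_ne_top_of_isPreconnected hUc hs hy hne hyord
  rw [meromorphicOrderAt_eq_top_iff] at hsord
  have hFG : F =ᶠ[𝓝[≠] s] G := by
    filter_upwards [hsord] with z hz using sub_eq_zero.mp hz
  exact (((hF.meromorphic ha).eventuallyEq_nhdsNE_iff_eventuallyEq_nhds
    (hG.meromorphic hb)).mp hFG).eq_of_nhds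

open Classical in
/-- `Θ(r, s, t, x)` for `Re (r + t) > 1`: the value at `s` of the meromorphic continuation, in the
second variable, of the double series. The value does not depend on the choice of the half-plane
and of the continuation. -/
noncomputable def Theta (r s t : ℂ) (x : ℝ) : ℂ :=
  if h : ∃ v : ℂ, ∃ a : ℝ, a < s.re ∧ ∃ F : ℂ → ℂ, IsThetaContinuation r t x a F ∧ F s = v
  then h.choose else 0

theorem Theta_eq {r t : ℂ} {x : ℝ} (hrt : 1 < (r + t).re) {a : ℝ} {F : ℂ → ℂ}
    (hF : IsThetaContinuation r t x a F) {s : ℂ} (ha : a < s.re) : Theta r s t x = F s := by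
  have h : ∃ v : ℂ, ∃ a : ℝ, a < s.re ∧ ∃ F : ℂ → ℂ, IsThetaContinuation r t x a F ∧ F s = v :=
    ⟨_, a, ha, F, hF, rfl⟩
  rw [Theta, dif_pos h]
  obtain ⟨b, hb, G, hG, hv⟩ := h.choose_spec
  rw [← hv]
  exact hG.eq hrt hF hb ha

/-- The first Stieltjes constant `γ₁ = lim_{n → ∞} (∑_{k = 1}^n log k / k - (log n)² / 2)`. -/
noncomputable def stieltjesGammaOne : ℝ :=
  limUnder atTop (fun n : ℕ =>
    ∑ k ∈ Finset.Icc 1 n, Real.log k / k - Real.log n ^ 2 / 2)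

/-- The limit defining the first Stieltjes constant exists. -/
theorem tendsto_stieltjesGammaOne :
    Tendsto (fun n : ℕ => ∑ k ∈ Finset.Icc 1 n, Real.log k / k - Real.log n ^ 2 / 2)
      atTop (𝓝 stieltjesGammaOne) := by
  have step : ∀ n : ℕ, 3 ≤ n →
      Real.log ((n + 1 : ℕ) : ℝ) / ((n + 1 : ℕ) : ℝ)
        ≤ Real.log ((n + 1 : ℕ) : ℝ) ^ 2 / 2 - Real.log n ^ 2 / 2 ∧
      Real.log ((n + 1 : ℕ) : ℝ) ^ 2 / 2 - Real.log n ^ 2 / 2 ≤ Real.log n / n := by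
    intro n hn
    have hn' : (3 : ℝ) ≤ n := by exact_mod_cast hn
    have hd : ∀ y : ℝ, 0 < y →
        HasDerivAt (fun y : ℝ => Real.log y ^ 2 / 2) (Real.log y / y) y := by
      intro y hy
      refine (((Real.hasDerivAt_log hy.ne').fun_pow 2).div_const 2).congr_deriv ?_
      norm_num
      field_simp
    obtain ⟨c, ⟨hc1, hc2⟩, hc⟩ := exists_hasDerivAt_eq_slope
      (fun y : ℝ => Real.log y ^ 2 / 2) (fun y => Real.log y / y)
      (show (n : ℝ) < ((n + 1 : ℕ) : ℝ) by push_cast; linarith)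
      (fun y hy => (hd y (by linarith [hy.1])).continuousAt.continuousWithinAt)
      (fun y hy => hd y (by linarith [hy.1]))
    have he : Real.exp 1 ≤ 3 := Real.exp_one_lt_d9.le.trans (by norm_num)
    have h1 : ((n + 1 : ℕ) : ℝ) - n = 1 := by push_cast; ring
    rw [h1, div_one] at hc
    rw [← hc]
    exact ⟨Real.log_div_self_antitoneOn (show Real.exp 1 ≤ c by linarith)
      (show Real.exp 1 ≤ ((n + 1 : ℕ) : ℝ) by linarith) hc2.le,
      Real.log_div_self_antitoneOn (show Real.exp 1 ≤ (n : ℝ) by linarith)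
      (show Real.exp 1 ≤ c by linarith) hc1.le⟩
  set u : ℕ → ℝ := fun n => ∑ k ∈ Finset.Icc 1 n, Real.log k / k - Real.log n ^ 2 / 2 with hu
  have hsucc : ∀ n : ℕ, u (n + 1) - u n = Real.log ((n + 1 : ℕ) : ℝ) / ((n + 1 : ℕ) : ℝ)
      - (Real.log ((n + 1 : ℕ) : ℝ) ^ 2 / 2 - Real.log n ^ 2 / 2) := by
    intro n
    simp only [hu]
    rw [Finset.sum_Icc_succ_top (by omega)]
    ring
  have hanti : Antitone (fun n : ℕ => u (n + 3)) := by
    refine antitone_nat_of_succ_le fun n => ?_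
    have h1 := hsucc (n + 3)
    have h2 := (step (n + 3) (by omega)).1
    have h3 : n + 1 + 3 = n + 3 + 1 := by omega
    rw [h3]; linarith
  have hlow : ∀ n : ℕ, u 3 - Real.log 3 / 3 ≤ u (n + 3) - Real.log ((n + 3 : ℕ) : ℝ) /
      ((n + 3 : ℕ) : ℝ) := by
    intro n
    induction n with
    | zero => norm_num
    | succ n ih =>
      have h1 := hsucc (n + 3)
      have h2 := (step (n + 3) (by omega)).2
      have h3 : n + 1 + 3 = n + 3 + 1 := by omega
      rw [h3]; linarith
  have hbdd : BddBelow (Set.range fun n : ℕ => u (n + 3)) := by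
    refine ⟨u 3 - Real.log 3 / 3, ?_⟩
    rintro _ ⟨n, rfl⟩
    have h : 0 ≤ Real.log ((n + 3 : ℕ) : ℝ) / ((n + 3 : ℕ) : ℝ) :=
      div_nonneg (Real.log_natCast_nonneg _) (Nat.cast_nonneg _)
    have := hlow n
    show u 3 - Real.log 3 / 3 ≤ u (n + 3)
    linarith
  have hlim := (tendsto_add_atTop_iff_nat 3).mp (tendsto_atTop_ciInf hanti hbdd)
  exact tendsto_nhds_limUnder ⟨_, hlim⟩

/-! For Re z > 0 the sum over n is elementary: with y = mx, partial fractions give (ψ(y + 1) + γ) /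
y. Writing ψ(mx + 1) = 1/(mx) + log m + log x + d(m), where d(m) = ψ(mx) - log(mx), turns x Θ(1, z,
1, x) into Σ d(m) / m^(1+z) + ζ(2+z)/x - ζ'(1+z) + (γ + log x) ζ(1+z).

Convexity of log Γ gives d(m) = O(1/m), so the first series is holomorphic for Re z > -1, and the
formula continues Θ there. The only pole is at z = 0 and comes from ζ and ζ' at 1. With ζ(s) =
1/(s-1) + ζ₀(s), ζ₀ entire, the constant term needs only ζ₀(1) = γ and ζ₀'(1) = -γ₁
(`deriv_riemannZeta₀_one`). The latter follows by comparing Σ log n / n^(1+s) with the integral of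
log t / t^(1+s) and letting s → 0+ under a uniform bound. -/

/-! ### The digamma function on the positive reals -/

theorem differentiableAt_log_Gamma {y : ℝ} (hy : 0 < y) :
    DifferentiableAt ℝ (Real.log ∘ Real.Gamma) y :=
  (Real.differentiableAt_Gamma fun m => ne_of_gt (by linarith [(m.cast_nonneg : (0 : ℝ) ≤ m)])).log
    (Real.Gamma_pos_of_pos hy).ne'

theorem log_Gamma_add_one {y : ℝ} (hy : 0 < y) :
    (Real.log ∘ Real.Gamma) (y + 1) = (Real.log ∘ Real.Gamma) y + Real.log y := by
  simp only [Function.comp_apply, Real.Gamma_add_one hy.ne',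
    Real.log_mul hy.ne' (Real.Gamma_pos_of_pos hy).ne', add_comm]

/-- On the positive reals the digamma function is the derivative of `log Γ`. -/
theorem digamma_ofReal {y : ℝ} (hy : 0 < y) :
    Complex.digamma (y : ℂ) = (deriv (Real.log ∘ Real.Gamma) y : ℝ) := by
  have hd : DifferentiableAt ℝ Real.Gamma y :=
    Real.differentiableAt_Gamma fun m => ne_of_gt (by linarith [(m.cast_nonneg : (0 : ℝ) ≤ m)])
  have hdc : DifferentiableAt ℂ Complex.Gamma (y : ℂ) := by
    refine Complex.differentiableAt_Gamma _ fun m h => ?_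
    have h' : y = -(m : ℝ) := by exact_mod_cast h
    linarith [(m.cast_nonneg : (0 : ℝ) ≤ m)]
  have hderiv : deriv Complex.Gamma (y : ℂ) = (deriv Real.Gamma y : ℝ) := by
    have h1 := hdc.hasDerivAt.comp_ofReal
    have h2 := hd.hasDerivAt.ofReal_comp
    simp only [← Complex.Gamma_ofReal] at h2
    exact h1.unique h2
  rw [Complex.digamma_def, logDeriv_apply, hderiv, Complex.Gamma_ofReal, Function.comp_def,
    deriv.log hd (Real.Gamma_pos_of_pos hy).ne', Complex.ofReal_div]

theorem deriv_log_Gamma_add_one {y : ℝ} (hy : 0 < y) :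
    deriv (Real.log ∘ Real.Gamma) (y + 1) = deriv (Real.log ∘ Real.Gamma) y + 1 / y := by
  rw [← deriv_comp_add_const, one_div, ← Real.deriv_log,
    ← deriv_add (differentiableAt_log_Gamma hy) (Real.differentiableAt_log hy.ne')]
  apply EventuallyEq.deriv_eq
  filter_upwards [eventually_gt_nhds hy] with z hz using log_Gamma_add_one hz

/-- The functional equation makes log y the slope of the convex function log Γ over [y, y + 1]; that
slope lies between the derivatives at the two endpoints. This is the left endpoint, the next lemma
the right one. -/
theorem deriv_log_Gamma_le_log {y : ℝ} (hy : 0 < y) :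
    deriv (Real.log ∘ Real.Gamma) y ≤ Real.log y := by
  refine (Real.convexOn_log_Gamma.deriv_le_slope (Set.mem_Ioi.mpr hy)
    (Set.mem_Ioi.mpr (by linarith : 0 < y + 1)) (by linarith)
    (differentiableAt_log_Gamma hy)).trans_eq ?_
  rw [slope_def_field, log_Gamma_add_one hy]
  ring

theorem log_le_deriv_log_Gamma_add_one {y : ℝ} (hy : 0 < y) :
    Real.log y ≤ deriv (Real.log ∘ Real.Gamma) (y + 1) := by
  refine le_trans (Eq.le ?_) (Real.convexOn_log_Gamma.slope_le_deriv (Set.mem_Ioi.mpr hy)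
    (Set.mem_Ioi.mpr (by linarith : 0 < y + 1)) (by linarith)
    (differentiableAt_log_Gamma (by linarith)))
  rw [slope_def_field, log_Gamma_add_one hy]
  ring

theorem abs_deriv_log_Gamma_sub_log_le {y : ℝ} (hy : 0 < y) :
    |deriv (Real.log ∘ Real.Gamma) y - Real.log y| ≤ 1 / y := by
  have h1 := deriv_log_Gamma_le_log hy
  have h2 := log_le_deriv_log_Gamma_add_one hy
  rw [deriv_log_Gamma_add_one hy] at h2
  rw [abs_le]
  constructor
  · linarith
  · have : 0 < 1 / y := by positivity
    linarith

theorem norm_digamma_sub_log_le {y : ℝ} (hy : 0 < y) :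
    ‖Complex.digamma (y : ℂ) - (Real.log y : ℂ)‖ ≤ 1 / y := by
  rw [digamma_ofReal hy, ← Complex.ofReal_sub, Complex.norm_real]
  exact abs_deriv_log_Gamma_sub_log_le hy

theorem deriv_log_Gamma_add_nat {y : ℝ} (hy : 0 < y) (n : ℕ) :
    deriv (Real.log ∘ Real.Gamma) (y + n) =
      deriv (Real.log ∘ Real.Gamma) y + ∑ k ∈ Finset.range n, 1 / (y + k) := by
  induction n with
  | zero => simp
  | succ n ih =>
    rw [Finset.sum_range_succ, Nat.cast_succ, ← add_assoc,
      deriv_log_Gamma_add_one (by positivity), ih, add_assoc]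

/-- `∑_{n ≥ 1} 1 / (n (n + y)) = (ψ (y + 1) + γ) / y`. -/
theorem hasSum_one_div_mul_add {y : ℝ} (hy : 0 < y) :
    HasSum (fun n : ℕ => 1 / (((n + 1 : ℕ) : ℝ) * (((n + 1 : ℕ) : ℝ) + y)))
      ((deriv (Real.log ∘ Real.Gamma) (y + 1) + Real.eulerMascheroniConstant) / y) := by
  rw [hasSum_iff_tendsto_nat_of_nonneg (fun n => by positivity)]
  -- Partial fractions: y / (n(n + y)) = 1/n - 1/(n + y). The term log N is inserted twice, so that
  -- one difference tends to γ and the other to 0.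
  have hsum : ∀ N : ℕ, ∑ n ∈ Finset.range N, 1 / (((n + 1 : ℕ) : ℝ) * (((n + 1 : ℕ) : ℝ) + y)) =
      (((harmonic N : ℚ) : ℝ) - Real.log N + deriv (Real.log ∘ Real.Gamma) (y + 1)
        - (deriv (Real.log ∘ Real.Gamma) (y + 1 + N) - Real.log N)) / y := by
    intro N
    rw [deriv_log_Gamma_add_nat (by linarith) N, harmonic]
    push_cast
    rw [eq_div_iff hy.ne', Finset.sum_mul]
    have : ∀ n : ℕ, 1 / (((n : ℝ) + 1) * ((n : ℝ) + 1 + y)) * y =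
        ((n : ℝ) + 1)⁻¹ - 1 / (y + 1 + n) := by
      intro n
      have h1 : (n : ℝ) + 1 ≠ 0 := by positivity
      have h2 : (n : ℝ) + 1 + y ≠ 0 := by positivity
      have h3 : y + 1 + n ≠ 0 := by positivity
      field_simp
      ring
    rw [Finset.sum_congr rfl fun n _ => this n, Finset.sum_sub_distrib]
    ring
  have hlog : Tendsto (fun N : ℕ => deriv (Real.log ∘ Real.Gamma) (y + 1 + N) - Real.log N)
      atTop (𝓝 0) := by
    have h1 : Tendsto (fun N : ℕ => Real.log ((N : ℝ) + (y + 1)) - Real.log N) atTop (𝓝 0) :=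
      (Real.tendsto_log_comp_add_sub_log (y + 1)).comp tendsto_natCast_atTop_atTop
    have h2 : Tendsto (fun N : ℕ => Real.log ((N : ℝ) + y) - Real.log N) atTop (𝓝 0) :=
      (Real.tendsto_log_comp_add_sub_log y).comp tendsto_natCast_atTop_atTop
    refine tendsto_of_tendsto_of_tendsto_of_le_of_le h2 h1 (fun N => ?_) (fun N => ?_)
    · have h := log_le_deriv_log_Gamma_add_one (show 0 < (N : ℝ) + y by positivity)
      rw [show (N : ℝ) + y + 1 = y + 1 + N by ring] at h
      simpa using h
    · have h := deriv_log_Gamma_le_log (show 0 < (N : ℝ) + (y + 1) by positivity)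
      rw [show (N : ℝ) + (y + 1) = y + 1 + N by ring] at h
      simp only [sub_le_sub_iff_right]
      rwa [show (N : ℝ) + (y + 1) = y + 1 + N by ring]
  simp only [hsum]
  have := ((Real.tendsto_harmonic_sub_log.add_const
    (deriv (Real.log ∘ Real.Gamma) (y + 1))).sub hlog).div_const y
  rwa [sub_zero, add_comm Real.eulerMascheroniConstant] at this

/-! ### The first Stieltjes constant and ζ' near 1 -/

/-- `v ↦ v e ^ {-s v}` has the primitive `-(v / s + 1 / s ^ 2) e ^ {-s v}`. -/
theorem hasDerivAt_mul_exp_primitive {s : ℝ} (hs : s ≠ 0) (v : ℝ) :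
    HasDerivAt (fun v : ℝ => -(v / s + 1 / s ^ 2) * Real.exp (-(s * v)))
      (v * Real.exp (-(s * v))) v := by
  have h1 : HasDerivAt (fun v : ℝ => -(v / s + 1 / s ^ 2)) (-(1 / s)) v :=
    (((hasDerivAt_id v).div_const s).add_const _).neg
  have h2 : HasDerivAt (fun v : ℝ => Real.exp (-(s * v))) (Real.exp (-(s * v)) * (-(s * 1))) v :=
    (((hasDerivAt_id v).const_mul s).neg).exp
  refine (h1.mul h2).congr_deriv ?_
  field_simp
  ring

theorem hasDerivAt_log_mul_exp_div (s : ℝ) {t : ℝ} (ht : 0 < t) :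
    HasDerivAt (fun t : ℝ => Real.log t * Real.exp (-(s * Real.log t)) / t)
      ((1 - (1 + s) * Real.log t) * Real.exp (-(s * Real.log t)) / t ^ 2) t := by
  have h1 := Real.hasDerivAt_log ht.ne'
  have h2 : HasDerivAt (fun t : ℝ => Real.exp (-(s * Real.log t)))
      (Real.exp (-(s * Real.log t)) * (-(s * t⁻¹))) t := ((h1.const_mul s).neg).exp
  refine ((h1.mul h2).div (hasDerivAt_id t) ht.ne').congr_deriv ?_
  simp only [id, Pi.mul_apply]
  field_simp
  ring

/-- Since log t ≤ 2 t^(1/2) and s ≤ 1, the first factor is at most 1 + 4 t^(1/2) ≤ 5 t^(1/2), and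
the exponential is at most 1. Uniformity in s is what dominated convergence needs. -/
theorem abs_deriv_log_mul_exp_div_le {s t : ℝ} (hs : 0 ≤ s) (hs1 : s ≤ 1) (ht : 1 ≤ t) :
    |(1 - (1 + s) * Real.log t) * Real.exp (-(s * Real.log t)) / t ^ 2| ≤
      5 / t ^ (3 / 2 : ℝ) := by
  have ht0 : 0 < t := by linarith
  have hl : 0 ≤ Real.log t := Real.log_nonneg ht
  have h1 : |1 - (1 + s) * Real.log t| ≤ 5 * t ^ (1 / 2 : ℝ) := by
    have h2 := Real.log_le_rpow_div ht0.le (show (0 : ℝ) < 1 / 2 by norm_num)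
    have h3 : 1 ≤ t ^ (1 / 2 : ℝ) := Real.one_le_rpow ht (by norm_num)
    have h4 : s * Real.log t ≤ Real.log t := mul_le_of_le_one_left hl hs1
    have h5 : 0 ≤ s * Real.log t := mul_nonneg hs hl
    rw [abs_le]
    constructor <;> linarith
  have h2 : Real.exp (-(s * Real.log t)) ≤ 1 :=
    Real.exp_le_one_iff.mpr (neg_nonpos.mpr (mul_nonneg hs hl))
  rw [abs_div, abs_mul, abs_of_pos (Real.exp_pos _), abs_of_pos (pow_pos ht0 2)]
  calc _ ≤ 5 * t ^ (1 / 2 : ℝ) * 1 / t ^ 2 := by gcongr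
    _ = 5 / t ^ (3 / 2 : ℝ) := by
      have h6 : t ^ 2 = t ^ (1 / 2 : ℝ) * t ^ (3 / 2 : ℝ) := by
        rw [← Real.rpow_add ht0, ← Real.rpow_natCast]; norm_num
      have h7 : t ^ (1 / 2 : ℝ) ≠ 0 := (Real.rpow_pos_of_pos ht0 _).ne'
      rw [h6, mul_one, mul_comm (5 : ℝ), mul_div_mul_left _ _ h7]

/-- The difference between `log n / n ^ (1 + s)` and the integral of `log t / t ^ (1 + s)` over
`[n, n + 1]`, for `n = k + 1` and after the substitution `t = e ^ v`. -/
noncomputable def logSumDefect (k : ℕ) (s : ℝ) : ℝ :=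
  Real.log (k + 1) * Real.exp (-(s * Real.log (k + 1))) / (k + 1) -
    ∫ v in Real.log (k + 1)..Real.log (k + 2), v * Real.exp (-(s * v))

theorem integral_mul_exp {s : ℝ} (hs : s ≠ 0) (a b : ℝ) :
    ∫ v in a..b, v * Real.exp (-(s * v)) =
      -(b / s + 1 / s ^ 2) * Real.exp (-(s * b)) - -(a / s + 1 / s ^ 2) * Real.exp (-(s * a)) :=
  intervalIntegral.integral_eq_sub_of_hasDerivAt
    (fun v _ => hasDerivAt_mul_exp_primitive hs v)
    (Continuous.intervalIntegrable (by fun_prop) _ _)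

/-- Two mean value theorems for f(t) = log t / t^(1+s): the integral over the unit interval is f(c),
and f(c) - f(k + 1) = f'(d)(c - (k + 1)) with k + 1 < d < c < k + 2. -/
theorem abs_logSumDefect_le (k : ℕ) {s : ℝ} (hs : 0 < s) (hs1 : s ≤ 1) :
    |logSumDefect k s| ≤ 5 / ((k + 1 : ℕ) : ℝ) ^ (3 / 2 : ℝ) := by
  have hk : (0 : ℝ) < k + 1 := by positivity
  have hk1 : (1 : ℝ) ≤ k + 1 := by linarith [(k.cast_nonneg : (0 : ℝ) ≤ k)]
  have hprim : ∀ t : ℝ, 0 < t → HasDerivAt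
      (fun t : ℝ => -(Real.log t / s + 1 / s ^ 2) * Real.exp (-(s * Real.log t)))
      (Real.log t * Real.exp (-(s * Real.log t)) / t) t := by
    intro t ht
    refine ((hasDerivAt_mul_exp_primitive hs.ne' (Real.log t)).comp t
      (Real.hasDerivAt_log ht.ne')).congr_deriv ?_
    rw [div_eq_mul_inv]
  obtain ⟨c, ⟨hc1, hc2⟩, hc⟩ := exists_hasDerivAt_eq_slope _ _
    (show (k : ℝ) + 1 < k + 2 by linarith)
    (fun t ht => (hprim t (by linarith [ht.1])).continuousAt.continuousWithinAt)
    (fun t ht => hprim t (by linarith [ht.1]))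
  obtain ⟨d, ⟨hd1, hd2⟩, hd⟩ := exists_hasDerivAt_eq_slope _ _ hc1
    (fun t ht => (hasDerivAt_log_mul_exp_div s
      (show 0 < t by linarith [ht.1])).continuousAt.continuousWithinAt)
    (fun t ht => hasDerivAt_log_mul_exp_div s (show 0 < t by linarith [ht.1]))
  rw [show (k : ℝ) + 2 - (k + 1) = 1 by ring, div_one] at hc
  have hcd : logSumDefect k s =
      -((1 - (1 + s) * Real.log d) * Real.exp (-(s * Real.log d)) / d ^ 2 * (c - (k + 1))) := by
    rw [logSumDefect, integral_mul_exp hs.ne', ← hc, hd,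
      div_mul_cancel₀ _ (sub_pos.mpr hc1).ne']
    ring
  rw [hcd, abs_neg, abs_mul, abs_of_pos (sub_pos.mpr hc1)]
  calc _ ≤ 5 / d ^ (3 / 2 : ℝ) * 1 := by
        exact mul_le_mul (abs_deriv_log_mul_exp_div_le hs.le hs1 (by linarith)) (by linarith)
          (by linarith) (by have : 0 < d := by linarith
                            positivity)
    _ ≤ 5 / ((k + 1 : ℕ) : ℝ) ^ (3 / 2 : ℝ) := by
        push_cast
        rw [mul_one]
        gcongr

/-- The integral form makes sense at s = 0, where the explicit primitive breaks down; this yields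
the termwise limits. -/
theorem continuous_logSumDefect (k : ℕ) : Continuous (logSumDefect k) := by
  refine Continuous.sub (by fun_prop) ?_
  exact intervalIntegral.continuous_parametric_intervalIntegral_of_continuous'
    (by fun_prop) _ _

theorem summable_logSumDefect_bound :
    Summable fun k : ℕ => 5 / ((k + 1 : ℕ) : ℝ) ^ (3 / 2 : ℝ) := by
  have h : Summable fun n : ℕ => 5 / (n : ℝ) ^ (3 / 2 : ℝ) := by
    simpa [div_eq_mul_inv] using
      (Real.summable_nat_rpow_inv.mpr (show (1 : ℝ) < 3 / 2 by norm_num)).mul_left 5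
  exact (summable_nat_add_iff 1).mpr h

/-- The pieces telescope to the integral of v e^(-sv) over (0, ∞), which is the double pole of -ζ'(1
+ s). -/
theorem hasSum_integral_mul_exp {s : ℝ} (hs : 0 < s) :
    HasSum (fun k : ℕ => ∫ v in Real.log (k + 1)..Real.log (k + 2), v * Real.exp (-(s * v)))
      (1 / s ^ 2) := by
  rw [hasSum_iff_tendsto_nat_of_nonneg]
  · have hsum : ∀ N : ℕ, ∑ k ∈ Finset.range N,
        ∫ v in Real.log (k + 1)..Real.log (k + 2), v * Real.exp (-(s * v)) =
        -(1 / s * (Real.log ((N : ℝ) + 1) * Real.exp (-(s * Real.log ((N : ℝ) + 1)))) +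
          1 / s ^ 2 * Real.exp (-(s * Real.log ((N : ℝ) + 1)))) + 1 / s ^ 2 := by
      intro N
      induction N with
      | zero => simp
      | succ N ih =>
        rw [Finset.sum_range_succ, ih, integral_mul_exp hs.ne']
        push_cast
        rw [show (N : ℝ) + 1 + 1 = N + 2 by ring]
        ring
    have hlog : Tendsto (fun N : ℕ => Real.log ((N : ℝ) + 1)) atTop atTop :=
      Real.tendsto_log_atTop.comp
        (tendsto_atTop_add_const_right _ _ tendsto_natCast_atTop_atTop)
    have h1 : Tendsto (fun v : ℝ => v * Real.exp (-(s * v))) atTop (𝓝 0) := by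
      have := Real.tendsto_pow_mul_exp_neg_atTop_nhds_zero 1
      have h2 := (this.comp (tendsto_id.const_mul_atTop hs)).const_mul s⁻¹
      rw [mul_zero] at h2
      refine h2.congr fun v => ?_
      simp only [Function.comp_apply, pow_one, id]
      field_simp
    have h2 : Tendsto (fun v : ℝ => Real.exp (-(s * v))) atTop (𝓝 0) :=
      Real.tendsto_exp_neg_atTop_nhds_zero.comp (tendsto_id.const_mul_atTop hs)
    simp only [hsum]
    have := ((((h1.comp hlog).const_mul (1 / s)).add
      ((h2.comp hlog).const_mul (1 / s ^ 2))).neg).add_const (1 / s ^ 2)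
    simpa using this
  · intro k
    have hk : (1 : ℝ) ≤ k + 1 := by linarith [(k.cast_nonneg : (0 : ℝ) ≤ k)]
    refine intervalIntegral.integral_nonneg (Real.log_le_log (by linarith) (by linarith)) ?_
    intro v hv
    exact mul_nonneg ((Real.log_nonneg hk).trans hv.1) (Real.exp_pos _).le

theorem tsum_logSumDefect_zero : ∑' k : ℕ, logSumDefect k 0 = stieltjesGammaOne := by
  -- The bound is available only for s > 0 and passes to s = 0 by continuity.
  have hbound : ∀ k, ‖logSumDefect k 0‖ ≤ 5 / ((k + 1 : ℕ) : ℝ) ^ (3 / 2 : ℝ) := by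
    intro k
    refine le_of_tendsto (f := fun s => ‖logSumDefect k s‖) (x := 𝓝[>] 0)
      ((continuous_logSumDefect k).norm.tendsto 0 |>.mono_left nhdsWithin_le_nhds) ?_
    filter_upwards [Ioc_mem_nhdsGT (show (0 : ℝ) < 1 by norm_num)] with s hs
    exact abs_logSumDefect_le k hs.1 hs.2
  have hsummable := Summable.of_norm_bounded summable_logSumDefect_bound hbound
  -- The integrals reach log(N + 1) while the sum stops at log N / N, hence the correction log(N +
  -- 1)/(N + 1), which vanishes in the limit.
  have hN : ∀ N : ℕ, ∑ k ∈ Finset.range N, logSumDefect k 0 =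
      (∑ k ∈ Finset.Icc 1 (N + 1), Real.log k / k - Real.log ((N + 1 : ℕ) : ℝ) ^ 2 / 2) -
        Real.log ((N + 1 : ℕ) : ℝ) / ((N + 1 : ℕ) : ℝ) := by
    intro N
    induction N with
    | zero => simp
    | succ N ih =>
      rw [Finset.sum_range_succ, ih, Finset.sum_Icc_succ_top (by omega : 1 ≤ N + 1 + 1)]
      simp only [logSumDefect, zero_mul, neg_zero, Real.exp_zero, mul_one, integral_id]
      push_cast
      rw [show (N : ℝ) + 1 + 1 = N + 2 by ring]
      ring
  have hlim : Tendsto (fun N : ℕ => Real.log ((N + 1 : ℕ) : ℝ) / ((N + 1 : ℕ) : ℝ))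
      atTop (𝓝 0) := by
    have h : Tendsto (fun t : ℝ => Real.log t / t) atTop (𝓝 0) := by
      simpa using Real.isLittleO_log_id_atTop.tendsto_div_nhds_zero
    exact h.comp (tendsto_natCast_atTop_atTop.comp (tendsto_add_atTop_nat 1))
  refine tendsto_nhds_unique hsummable.hasSum.tendsto_sum_nat ?_
  simp only [hN]
  simpa using ((tendsto_add_atTop_iff_nat 1).mpr tendsto_stieltjesGammaOne).sub hlim

/-- Near `s = 1` one has `ζ s = 1 / (s - 1) + γ - γ₁ (s - 1) + O((s - 1) ^ 2)`. -/
theorem deriv_riemannZeta₀_one : deriv riemannZeta₀ 1 = -(stieltjesGammaOne : ℂ) := by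
  -- Subtracting the integrals, whose sum is 1/s², from Σ log n / n^(1+s) = -ζ'(1 + s) removes
  -- exactly the polar part.
  have hz : ∀ s : ℝ, 0 < s →
      -deriv riemannZeta₀ (1 + s : ℂ) = ((∑' k : ℕ, logSumDefect k s : ℝ) : ℂ) := by
    intro s hs
    have hs0 : (s : ℂ) ≠ 0 := by exact_mod_cast hs.ne'
    have hre : 1 < (1 + s : ℂ).re := by simpa using hs
    have habs : LSeries.abscissaOfAbsConv 1 < ((1 + s : ℂ).re : EReal) := by
      rw [LSeries.abscissaOfAbsConv_one]; exact_mod_cast hre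
    have h1 : deriv riemannZeta (1 + s : ℂ) = -LSeries (LSeries.logMul 1) (1 + s) := by
      rw [← LSeries_deriv habs]
      refine EventuallyEq.deriv_eq ?_
      filter_upwards [(isOpen_lt continuous_const Complex.continuous_re).mem_nhds hre] with z hz
      exact (LSeries_one_eq_riemannZeta hz).symm
    rw [deriv_riemannZeta_eq_neg_inv_sub_sq_add (by simpa using hs0)] at h1
    have hsum : HasSum (fun k : ℕ => LSeries.term (LSeries.logMul 1) (1 + s) (k + 1))
        (LSeries (LSeries.logMul 1) (1 + s)) := by
      rw [hasSum_nat_add_iff 1]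
      simp only [Finset.range_one, Finset.sum_singleton, LSeries.term_zero, add_zero]
      exact (LSeriesSummable_logMul_of_lt_re habs).hasSum
    have hterm : ∀ k : ℕ, LSeries.term (LSeries.logMul 1) (1 + s) (k + 1) =
        ((Real.log (k + 1) * Real.exp (-(s * Real.log (k + 1))) / (k + 1) : ℝ) : ℂ) := by
      intro k
      have hk : (0 : ℝ) < k + 1 := by positivity
      rw [LSeries.term_of_ne_zero k.succ_ne_zero, LSeries.logMul, ← Complex.natCast_log]
      have : ((k + 1 : ℕ) : ℂ) ^ (1 + s : ℂ) = (((k + 1 : ℝ) ^ (1 + s) : ℝ) : ℂ) := by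
        rw [Complex.ofReal_cpow hk.le]; push_cast; rfl
      rw [this, Real.rpow_add hk, Real.rpow_one, Real.rpow_def_of_pos hk, Real.exp_neg]
      push_cast
      simp only [Pi.one_apply, mul_one]
      rw [mul_comm (Complex.ofReal (Real.log (↑k + 1))) (s : ℂ), div_mul_eq_div_div, div_right_comm,
        div_eq_mul_inv _ (Complex.exp _)]
    have h2 : HasSum (fun k => ((logSumDefect k s : ℝ) : ℂ))
        (LSeries (LSeries.logMul 1) (1 + s) - ((1 / s ^ 2 : ℝ) : ℂ)) := by
      have := hsum.sub (Complex.hasSum_ofReal.mpr (hasSum_integral_mul_exp hs))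
      simp only [hterm, ← Complex.ofReal_sub] at this
      exact this
    rw [Complex.ofReal_tsum, h2.tsum_eq]
    have h3 : LSeries (LSeries.logMul 1) (1 + s) =
      (1 + (s : ℂ) - 1)⁻¹ ^ 2 - deriv riemannZeta₀ (1 + s) := by linear_combination h1
    rw [h3]
    push_cast
    rw [add_sub_cancel_left]
    field_simp
    ring
  have hlim : Tendsto (fun s : ℝ => ((∑' k : ℕ, logSumDefect k s : ℝ) : ℂ)) (𝓝[>] 0)
      (𝓝 (stieltjesGammaOne : ℂ)) := by
    refine (Complex.continuous_ofReal.tendsto _).comp ?_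
    rw [← tsum_logSumDefect_zero]
    refine tendsto_tsum_of_dominated_convergence summable_logSumDefect_bound
      (fun k => ((continuous_logSumDefect k).tendsto 0).mono_left nhdsWithin_le_nhds) ?_
    filter_upwards [Ioc_mem_nhdsGT (show (0 : ℝ) < 1 by norm_num)] with s hs k
    exact abs_logSumDefect_le k hs.1 hs.2
  have hleft : Tendsto (fun s : ℝ => -deriv riemannZeta₀ (1 + s : ℂ)) (𝓝[>] 0)
      (𝓝 (-deriv riemannZeta₀ 1)) := by
    have hc : Continuous fun s : ℝ => -deriv riemannZeta₀ (1 + s : ℂ) :=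
      (differentiable_riemannZeta₀.deriv.continuous.comp (by fun_prop)).neg
    simpa using (hc.tendsto 0).mono_left (nhdsWithin_le_nhds (s := Set.Ioi 0))
  have := tendsto_nhds_unique (hleft.congr' (by
    filter_upwards [self_mem_nhdsWithin] with s hs using hz s hs)) hlim
  rw [← this, neg_neg]

/-! ### The meromorphic continuation -/

/-- The coefficients `ψ (m x) - log (m x)`. -/
noncomputable def digammaDefect (x : ℝ) (m : ℕ) : ℂ :=
  Complex.digamma ((m : ℂ) * (x : ℂ)) - (Real.log ((m : ℝ) * x) : ℂ)

theorem norm_digammaDefect_le {x : ℝ} (hx : 0 < x) {m : ℕ} (hm : m ≠ 0) :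
    ‖digammaDefect x m‖ ≤ 1 / x * (m : ℝ) ^ (-1 : ℝ) := by
  have hm' : (0 : ℝ) < m := by positivity
  have := norm_digamma_sub_log_le (mul_pos hm' hx)
  rw [Complex.ofReal_mul, Complex.ofReal_natCast] at this
  refine this.trans_eq ?_
  rw [Real.rpow_neg_one]
  field_simp

theorem abscissaOfAbsConv_digammaDefect {x : ℝ} (hx : 0 < x) :
    LSeries.abscissaOfAbsConv (digammaDefect x) ≤ 0 := by
  have := LSeries.abscissaOfAbsConv_le_of_le_const_mul_rpow (f := digammaDefect x) (x := -1)
    ⟨1 / x, fun n hn => norm_digammaDefect_le hx hn⟩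
  refine this.trans_eq ?_
  norm_cast

theorem abscissaOfAbsConv_digammaDefect_lt {x : ℝ} (hx : 0 < x) {z : ℂ} (hz : 0 < z.re) :
    LSeries.abscissaOfAbsConv (digammaDefect x) < z.re :=
  (abscissaOfAbsConv_digammaDefect hx).trans_lt (by exact_mod_cast hz)

theorem hasSum_pnat_term {f : ℕ → ℂ} {s a : ℂ} (h : LSeriesHasSum f s a) :
    HasSum (fun m : ℕ+ => f m / ((m : ℕ) : ℂ) ^ s) a := by
  have h' : HasSum (fun m : ℕ+ => LSeries.term f s m) a := by
    rw [hasSum_pnat_iff]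
    simp only [LSeries.term_zero, add_zero]
    exact h
  refine h'.congr_fun fun m => ?_
  rw [LSeries.term_of_ne_zero m.ne_zero]

/-- The holomorphic part of the continuation of `z ↦ x Θ(1, z, 1, x)` to `Re z > -1`. -/
noncomputable def thetaRegularPart (x : ℝ) (z : ℂ) : ℂ :=
  LSeries (digammaDefect x) (1 + z) + riemannZeta (2 + z) / x - deriv riemannZeta₀ (1 + z) +
    (Real.eulerMascheroniConstant + Real.log x) * riemannZeta₀ (1 + z)

/-- The continuation of `z ↦ Θ(1, z, 1, x)` to `Re z > -1`, with the value `0` at the pole. -/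
noncomputable def thetaContinuation (x : ℝ) (z : ℂ) : ℂ :=
  z ^ (-2 : ℤ) * ((z ^ 2 * thetaRegularPart x z +
    (Real.eulerMascheroniConstant + Real.log x) * z + 1) / x)

theorem analyticOnNhd_thetaRegularPart {x : ℝ} (hx : 0 < x) :
    AnalyticOnNhd ℂ (thetaRegularPart x) {z : ℂ | -1 < z.re} := by
  refine DifferentiableOn.analyticOnNhd (fun z hz => ?_)
    (isOpen_lt continuous_const Complex.continuous_re)
  have hz' : -1 < z.re := hz
  refine DifferentiableAt.differentiableWithinAt ?_
  have h1 : DifferentiableAt ℂ (fun z => LSeries (digammaDefect x) (1 + z)) z :=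
    (LSeries_hasDerivAt (abscissaOfAbsConv_digammaDefect_lt hx (z := 1 + z) (by
      simp only [Complex.add_re, Complex.one_re]; linarith))).differentiableAt.comp z (by fun_prop)
  have h2 : DifferentiableAt ℂ (fun z => riemannZeta (2 + z)) z := by
    refine (differentiableAt_riemannZeta fun h => ?_).comp z (by fun_prop)
    have := congrArg Complex.re h
    simp only [Complex.add_re, Complex.re_ofNat, Complex.one_re] at this
    linarith
  have h3 : DifferentiableAt ℂ (fun z => deriv riemannZeta₀ (1 + z)) z :=
    (differentiable_riemannZeta₀.deriv _).comp z (by fun_prop)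
  have h4 : DifferentiableAt ℂ (fun z => riemannZeta₀ (1 + z)) z :=
    (differentiable_riemannZeta₀ _).comp z (by fun_prop)
  exact ((h1.add (h2.div_const _)).sub h3).add (h4.const_mul _)

theorem meromorphicNFOn_thetaContinuation {x : ℝ} (hx : 0 < x) :
    MeromorphicNFOn (thetaContinuation x) {z : ℂ | -1 < z.re} := by
  intro z hz
  have hx' : (x : ℂ) ≠ 0 := by exact_mod_cast hx.ne'
  have hR := analyticOnNhd_thetaRegularPart hx z hz
  have hg : AnalyticAt ℂ (fun z => (z ^ 2 * thetaRegularPart x z +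
    (Real.eulerMascheroniConstant + Real.log x) * z + 1) / (x : ℂ)) z := by
    fun_prop (disch := exact hx')
  -- At 0 the factor multiplying z^(-2) takes the value 1/x ≠ 0. The convention 0^(-2) = 0 makes the
  -- factorization hold at 0 itself, as the normal form requires.
  rcases eq_or_ne z 0 with rfl | h0
  · refine Or.inr ⟨-2, _, hg, by simpa using hx', ?_⟩
    filter_upwards with w
    simp [thetaContinuation]
  · refine AnalyticAt.meromorphicNFAt ?_
    exact (analyticAt_id.zpow h0).mul hg

theorem thetaContinuation_of_ne_zero (x : ℝ) {z : ℂ} (hz : z ≠ 0) :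
    thetaContinuation x z = (thetaRegularPart x z +
      (Real.eulerMascheroniConstant + Real.log x) / z + 1 / z ^ 2) / x := by
  rw [thetaContinuation, zpow_neg]
  norm_cast
  field_simp

/-! ### Evaluation of the double series -/

/-- The sum over `n` in the double series. -/
theorem hasSum_theta_inner {x : ℝ} (hx : 0 < x) (m : ℕ+) :
    HasSum (fun n : ℕ+ => 1 / ((n : ℝ) * ((n : ℝ) + (m : ℝ) * x)))
      ((deriv (Real.log ∘ Real.Gamma) ((m : ℝ) * x + 1) + Real.eulerMascheroniConstant) /
        ((m : ℝ) * x)) := by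
  have hm : (0 : ℝ) < m := by exact_mod_cast m.pos
  exact (hasSum_pnat_iff_hasSum_succ
    (f := fun n : ℕ => 1 / ((n : ℝ) * ((n : ℝ) + (m : ℝ) * x)))).mpr
    (hasSum_one_div_mul_add (mul_pos hm hx))

/-- The sum over `m` of the inner sums of the double series. -/
theorem hasSum_theta_outer {x : ℝ} (hx : 0 < x) {z : ℂ} (hz : 0 < z.re) :
    HasSum (fun m : ℕ+ => 1 / ((m : ℕ) : ℂ) ^ z *
      (((deriv (Real.log ∘ Real.Gamma) ((m : ℝ) * x + 1) + Real.eulerMascheroniConstant) /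
        ((m : ℝ) * x) : ℝ) : ℂ)) (thetaContinuation x z) := by
  have hz0 : z ≠ 0 := by rintro rfl; simp at hz
  have hx' : (x : ℂ) ≠ 0 := by exact_mod_cast hx.ne'
  have hre1 : 1 < (1 + z).re := by simpa using hz
  have hre2 : 1 < (2 + z).re := by simp only [Complex.add_re, Complex.re_ofNat]; linarith
  have habs : LSeries.abscissaOfAbsConv 1 < ((1 + z).re : EReal) := by
    rw [LSeries.abscissaOfAbsConv_one]; exact_mod_cast hre1
  have hne1 : (1 + z) ≠ 1 := by simpa using hz0
  have hderiv : LSeries (LSeries.logMul 1) (1 + z) = z⁻¹ ^ 2 - deriv riemannZeta₀ (1 + z) := by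
    have h : deriv riemannZeta (1 + z) = -LSeries (LSeries.logMul 1) (1 + z) := by
      rw [← LSeries_deriv habs]
      refine EventuallyEq.deriv_eq ?_
      filter_upwards [(isOpen_lt continuous_const Complex.continuous_re).mem_nhds hre1] with w hw
      exact (LSeries_one_eq_riemannZeta hw).symm
    rw [deriv_riemannZeta_eq_neg_inv_sub_sq_add hne1, add_sub_cancel_left] at h
    linear_combination h
  -- The four Dirichlet series match the summands of ψ(mx + 1) + γ = d(m) + 1/(mx) + log m + (γ +
  -- log x).
  have hc := hasSum_pnat_term (LSeriesSummable_of_abscissaOfAbsConv_lt_re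
    (abscissaOfAbsConv_digammaDefect_lt hx (z := 1 + z) (by linarith))).LSeriesHasSum
  have h2 := hasSum_pnat_term (LSeriesHasSum_one hre2)
  have hl := hasSum_pnat_term (LSeriesSummable_logMul_of_lt_re habs).LSeriesHasSum
  have h1 := hasSum_pnat_term (LSeriesHasSum_one hre1)
  rw [riemannZeta_eq_inv_sub_add hne1, add_sub_cancel_left] at h1
  rw [hderiv] at hl
  have := (((hc.add (h2.div_const (x : ℂ))).add hl).add
    (h1.mul_left (Real.eulerMascheroniConstant + Real.log x : ℂ))).div_const (x : ℂ)
  have hval : thetaContinuation x z = (LSeries (digammaDefect x) (1 + z) +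
      riemannZeta (2 + z) / x + (z⁻¹ ^ 2 - deriv riemannZeta₀ (1 + z)) +
      (Real.eulerMascheroniConstant + Real.log x) * (z⁻¹ + riemannZeta₀ (1 + z))) / x := by
    rw [thetaContinuation_of_ne_zero x hz0, thetaRegularPart]
    field_simp
    ring
  rw [hval]
  refine this.congr_fun fun m => ?_
  have hm : (0 : ℝ) < m := by exact_mod_cast m.pos
  have hm' : ((m : ℕ) : ℂ) ≠ 0 := by exact_mod_cast m.ne_zero
  have hp : ((m : ℕ) : ℂ) ^ z ≠ 0 := by simp [Complex.cpow_eq_zero_iff, hm']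
  have hd : ((deriv (Real.log ∘ Real.Gamma) ((m : ℝ) * x) : ℝ) : ℂ) =
      digammaDefect x m + (Real.log m + Real.log x : ℝ) := by
    rw [digammaDefect, ← Real.log_mul hm.ne' hx.ne', sub_add_cancel,
      ← digamma_ofReal (mul_pos hm hx)]
    push_cast
    rfl
  rw [deriv_log_Gamma_add_one (mul_pos hm hx)]
  push_cast at hd ⊢
  rw [hd, LSeries.logMul, ← Complex.natCast_log, show (2 + z : ℂ) = 1 + (1 + z) by ring,
    Complex.cpow_add 1 (1 + z) hm', Complex.cpow_add 1 z hm', Complex.cpow_one]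
  simp only [Pi.one_apply]
  field_simp
  ring

theorem theta_term_eq {x : ℝ} (z : ℂ) (n m : ℕ+) :
    1 / (((n : ℕ) : ℂ) ^ (1 : ℂ) * ((m : ℕ) : ℂ) ^ z *
      (((((n : ℕ) : ℝ) + ((m : ℕ) : ℝ) * x : ℝ)) : ℂ) ^ (1 : ℂ)) =
    1 / ((m : ℕ) : ℂ) ^ z * ((1 / ((n : ℝ) * ((n : ℝ) + (m : ℝ) * x)) : ℝ) : ℂ) := by
  rw [Complex.cpow_one, Complex.cpow_one]
  push_cast
  simp only [one_div, mul_inv]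
  ring

/-- The closed form sums over n first, the definition over m first. The exchange is legitimate
because, up to the factor m^(-z), the terms are positive: the norm of each inner sum is the sum of
the norms, and the outer series converges absolutely. -/
theorem thetaSeries_eq_thetaContinuation {x : ℝ} (hx : 0 < x) {z : ℂ} (hz : 0 < z.re) :
    thetaSeries 1 z 1 x = thetaContinuation x z := by
  set f : ℕ+ → ℕ+ → ℂ := fun m n =>
    1 / ((m : ℕ) : ℂ) ^ z * ((1 / ((n : ℝ) * ((n : ℝ) + (m : ℝ) * x)) : ℝ) : ℂ) with hf
  have hinner : ∀ m : ℕ+, HasSum (f m) (1 / ((m : ℕ) : ℂ) ^ z *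
      (((deriv (Real.log ∘ Real.Gamma) ((m : ℝ) * x + 1) + Real.eulerMascheroniConstant) /
        ((m : ℝ) * x) : ℝ) : ℂ)) := fun m =>
    (Complex.hasSum_ofReal.mpr (hasSum_theta_inner hx m)).mul_left _
  have hnorm : ∀ m n : ℕ+, ‖f m n‖ = ‖1 / ((m : ℕ) : ℂ) ^ z‖ *
      (1 / ((n : ℝ) * ((n : ℝ) + (m : ℝ) * x))) := by
    intro m n
    rw [hf, norm_mul, Complex.norm_real, Real.norm_of_nonneg (by positivity)]
  have hsummable : Summable (Function.uncurry f) := by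
    refine Summable.of_norm ((summable_prod_of_nonneg fun _ => norm_nonneg _).mpr ⟨fun m => ?_, ?_⟩)
    · exact (hinner m).summable.norm
    · refine (hasSum_theta_outer hx hz).summable.norm.congr fun m => ?_
      have h := (hasSum_theta_inner hx m).mul_left ‖1 / ((m : ℕ) : ℂ) ^ z‖
      simp only [Function.uncurry_apply_pair, hnorm]
      rw [h.tsum_eq, norm_mul, Complex.norm_real, Real.norm_of_nonneg]
      exact (hasSum_theta_inner hx m).nonneg fun n => by positivity
  calc thetaSeries 1 z 1 x = ∑' n : ℕ+, ∑' m : ℕ+, f m n := by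
        simp only [thetaSeries, theta_term_eq, hf]
    _ = ∑' m : ℕ+, ∑' n : ℕ+, f m n := hsummable.tsum_comm
    _ = thetaContinuation x z := by
        simp only [fun m => (hinner m).tsum_eq]
        exact (hasSum_theta_outer hx hz).tsum_eq

theorem isThetaContinuation_thetaContinuation {x : ℝ} (hx : 0 < x) :
    IsThetaContinuation 1 1 x (-1) (thetaContinuation x) where
  meromorphic := meromorphicNFOn_thetaContinuation hx
  eq_series z _ hz := by
    refine (thetaSeries_eq_thetaContinuation hx ?_).symm
    have := hz.2.1
    simp only [Complex.add_re, Complex.one_re] at this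
    linarith

/-! ### The expansion at s = 0 -/

theorem hasSum_digammaDefect_div {x : ℝ} (hx : 0 < x) :
    HasSum (fun m : ℕ+ => digammaDefect x m / ((m : ℕ) : ℂ)) (LSeries (digammaDefect x) 1) := by
  simpa using hasSum_pnat_term (LSeriesSummable_of_abscissaOfAbsConv_lt_re
    (abscissaOfAbsConv_digammaDefect_lt hx (z := 1) (by simp))).LSeriesHasSum

theorem corollary8 (x : ℝ) (hx : 0 < x) :
    Summable (fun m : ℕ+ =>
      (Complex.digamma (((m : ℕ) : ℂ) * (x : ℂ)) - (Real.log (((m : ℕ) : ℝ) * x) : ℂ))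
        / ((m : ℕ) : ℂ)) ∧
    (fun s : ℂ => Theta 1 s 1 x -
      (1 / ((x : ℂ) * s ^ 2)
        + ((Real.eulerMascheroniConstant : ℂ) + (Real.log x : ℂ)) / ((x : ℂ) * s)
        + 1 / (x : ℂ) *
          ((Real.eulerMascheroniConstant : ℂ) *
            ((Real.eulerMascheroniConstant : ℂ) + (Real.log x : ℂ)) + (stieltjesGammaOne : ℂ))
        + riemannZeta 2 / (x : ℂ) ^ 2
        + 1 / (x : ℂ) * ∑' m : ℕ+,
          (Complex.digamma (((m : ℕ) : ℂ) * (x : ℂ)) - (Real.log (((m : ℕ) : ℝ) * x) : ℂ))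
            / ((m : ℕ) : ℂ)))
      =O[𝓝[≠] (0 : ℂ)] (fun s : ℂ => s) := by
  have hx' : (x : ℂ) ≠ 0 := by exact_mod_cast hx.ne'
  have hsum := hasSum_digammaDefect_div hx
  refine ⟨hsum.summable, ?_⟩
  have htsum : (∑' m : ℕ+, (Complex.digamma (((m : ℕ) : ℂ) * (x : ℂ)) -
      (Real.log (((m : ℕ) : ℝ) * x) : ℂ)) / ((m : ℕ) : ℂ)) = LSeries (digammaDefect x) 1 :=
    hsum.tsum_eq
  rw [htsum]
  -- The polar terms cancel exactly, so the error is 1/x times the increment of the regular part,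
  -- which is O(s) by differentiability at 0.
  have hR : (fun s : ℂ => thetaRegularPart x s - thetaRegularPart x 0) =O[𝓝 0] fun s : ℂ => s := by
    simpa using (analyticOnNhd_thetaRegularPart hx 0 (by simp)).differentiableAt.isBigO_sub
  have hR0 : thetaRegularPart x 0 = LSeries (digammaDefect x) 1 + riemannZeta 2 / x +
      stieltjesGammaOne + (Real.eulerMascheroniConstant + Real.log x) *
        Real.eulerMascheroniConstant := by
    simp [thetaRegularPart, deriv_riemannZeta₀_one]
  refine ((hR.const_mul_left (1 / (x : ℂ))).mono nhdsWithin_le_nhds).congr' ?_ EventuallyEq.rfl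
  have hre : {s : ℂ | -1 < s.re} ∈ 𝓝[≠] (0 : ℂ) := mem_nhdsWithin_of_mem_nhds
    ((isOpen_lt continuous_const Complex.continuous_re).mem_nhds (by simp))
  filter_upwards [hre, self_mem_nhdsWithin] with s hs hs0
  have hs0' : s ≠ 0 := hs0
  rw [Theta_eq (by norm_num) (isThetaContinuation_thetaContinuation hx) hs,
    thetaContinuation_of_ne_zero x hs0', hR0]
  field_simp
  ring
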